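/- Let $d\ge 3$ and $k\ge 1$ be integers. A lattice $d$-simplex is the convex hull in $\mathbb R^d$ of $d+1$ affinely independent points of $\mathbb Z^d$; it is a clean $k$-point simplex if the only lattice points on its boundary are its vertices and its interior contains exactly $k$ lattice points. Let $T$ be a clean $k$-point lattice $d$-simplex with $\operatorname{Vol}(T)=\frac{dk+1}{d!}$, and let $S$ be the simplex whose vertices are the origin, the unit vectors $e_1,\dots,e_{d-1}$ and the point $(dk,\dots,dk,dk+1)$ (the first $d-1$ coordinates equal to $dk$). Then $T$ is unimodularly equivalent to $S$: there are a $d\times d$ integer matrix $M$ with $\det M=\pm1$ and a vector $u\in\mathbb Z^d$ such that $T=\{vM+u : v\in S\}$, where points of $\mathbb R^d$ are row vectors. -/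

import Mathlib

open MeasureTheory
open scoped Nat Matrix

/-- The integer lattice `ℤ^d` inside `ℝ^d`. -/
def latticePoints (d : ℕ) : Set (Fin d → ℝ) :=
  Set.range fun (z : Fin d → ℤ) (i : Fin d) => (z i : ℝ)

/-- `T ⊆ ℝ^d` is a lattice `d`-simplex: the convex hull of `d + 1` affinely independent
points of `ℤ^d`. -/
def IsLatticeSimplex (d : ℕ) (T : Set (Fin d → ℝ)) : Prop :=
  ∃ s : Affine.Simplex ℝ (Fin d → ℝ) d,
    (∀ i, s.points i ∈ latticePoints d) ∧ T = convexHull ℝ (Set.range s.points)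

/-- `P` is clean: the lattice points on its boundary are exactly its vertices
(for a polytope, the vertices are the extreme points). -/
def IsClean (d : ℕ) (P : Set (Fin d → ℝ)) : Prop :=
  frontier P ∩ latticePoints d = P.extremePoints ℝ

/-- The collection of clean `k`-point lattice `d`-simplices: clean lattice `d`-simplices whose
interior contains exactly `k` lattice points. -/
def cleanLatticeSimplices (k d : ℕ) : Set (Set (Fin d → ℝ)) :=
  {T | IsLatticeSimplex d T ∧ IsClean d T ∧ (interior T ∩ latticePoints d).encard = k}

/-- The affine map `v ↦ v · M + u` of `ℝ^d`, for an integer matrix `M` and an integer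
vector `u`; the vector `v` is a row vector. -/
def integerAffineMap {d : ℕ} (M : Matrix (Fin d) (Fin d) ℤ) (u : Fin d → ℤ)
    (v : Fin d → ℝ) : Fin d → ℝ :=
  v ᵥ* M.map (fun z : ℤ => (z : ℝ)) + fun i => (u i : ℝ)

/-- `P₁` and `P₂` are unimodularly equivalent: `P₁ = f(P₂)` for a map `f(v) = v · M + u` with `M`
and `u` integral and `det M = ± 1`. -/
def UnimodularlyEquivalent {d : ℕ} (P₁ P₂ : Set (Fin d → ℝ)) : Prop :=
  ∃ (M : Matrix (Fin d) (Fin d) ℤ) (u : Fin d → ℤ),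
    (M.det = 1 ∨ M.det = -1) ∧ P₁ = integerAffineMap M u '' P₂

/-- The simplex `T_{a_1, …, a_d}`: the convex hull of the origin, the unit points
`e_1, …, e_{d-1}` and the point `(a_1, …, a_d)`. With coordinates indexed from `0`, the unit
points that occur are those of index `i` with `i + 1 < d`. -/
def pointSimplex {d : ℕ} (a : Fin d → ℤ) : Set (Fin d → ℝ) :=
  convexHull ℝ
    ({0} ∪ {x | ∃ i : Fin d, (i : ℕ) + 1 < d ∧ x = Pi.single i 1} ∪ {fun i => (a i : ℝ)})

/-- The integer vector `(dk, …, dk, dk + 1)`. -/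
def extremalPoint (k d : ℕ) : Fin d → ℤ :=
  fun i => if (i : ℕ) + 1 = d then (d : ℤ) * k + 1 else (d : ℤ) * k

/-! Write the vertices as rows `(1, v_i)` of an integer matrix `M` and mark a finite set `P` of
lattice points. Star subdivision at a marked point `q` replaces one row at a time by `q`. The pieces
have determinants `scaledBary M q i`, which add up to `det M`, and there are `1 + faceDim M q` of
them. No other marked point loses total face dimension, so induction on the determinant gives `1 + ∑
faceDim ≤ det M` (`one_add_sum_faceDim_le_det`). With `k` interior points this reads `dk + 1 ≤ det
M`, so the hypothesis on the volume is the equality case `IsTight`.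

Equality passes to every piece and makes the face dimension of each other marked point exactly
additive (`IsTight.updateRow_and`). For interior `q` and `z`, if `m` coordinates attain the minimal
ratio of `z` to `q`, then `m(d + 1 - m) = d`, so `m` is `1` or `d`. Tightness also gives an interior
point `p` at lattice distance one from a chosen facet, and every marked point is congruent to a
multiple of `p` in barycentric coordinates modulo `N = dk + 1`. Arithmetic with these facts
(`weights_eq_of_ratioArgmin_card`) leaves the coordinates `(1, k, …, k)`, or all equal to `1` with
one exception. Either way some lattice point has coordinates `(N - d, 1, …, 1)`, and this determines
the simplex up to unimodular equivalence. -/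

/-! ### Integral barycentric coordinates and star subdivision. -/

section Barycentric

variable {ι : Type*} [Fintype ι] [DecidableEq ι]

/-- The `i`-th barycentric coordinate of `z` with respect to the rows of `M`, scaled by `M.det`. -/
def scaledBary (M : Matrix ι ι ℤ) (z : ι → ℤ) (i : ι) : ℤ := (M.updateRow i z).det

theorem sum_scaledBary_smul (M : Matrix ι ι ℤ) (z : ι → ℤ) :
    ∑ i, scaledBary M z i • M i = M.det • z := by
  have h := Matrix.mulVec_cramer Mᵀ z
  rw [Matrix.det_transpose] at h
  rw [← h]
  ext j
  simp only [Finset.sum_apply, Pi.smul_apply, smul_eq_mul, Matrix.mulVec, dotProduct,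
    Matrix.transpose_apply, Matrix.cramer_transpose_apply, scaledBary]
  exact Finset.sum_congr rfl fun i _ => mul_comm _ _

theorem scaledBary_row_self (M : Matrix ι ι ℤ) (i : ι) : scaledBary M (M i) i = M.det := by
  simp [scaledBary, Matrix.updateRow_eq_self]

theorem scaledBary_row_of_ne (M : Matrix ι ι ℤ) {i j : ι} (h : j ≠ i) :
    scaledBary M (M j) i = 0 := by
  refine Matrix.det_zero_of_row_eq h ?_
  rw [Matrix.updateRow_ne h, Matrix.updateRow_self]

theorem scaledBary_sum_smul (M : Matrix ι ι ℤ) (c : ι → ℤ) (z : ι → (ι → ℤ)) (i : ι) :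
    scaledBary M (∑ l, c l • z l) i = ∑ l, c l * scaledBary M (z l) i := by
  simp only [scaledBary, ← Matrix.cramer_transpose_apply, map_sum, map_smul, Finset.sum_apply,
    Pi.smul_apply, smul_eq_mul]

theorem scaledBary_smul (M : Matrix ι ι ℤ) (c : ℤ) (z : ι → ℤ) (i : ι) :
    scaledBary M (c • z) i = c * scaledBary M z i := by
  simp only [scaledBary, ← Matrix.cramer_transpose_apply, map_smul, Pi.smul_apply, smul_eq_mul]

theorem sum_scaledBary (M : Matrix ι ι ℤ) (h : (ι → ℤ) →ₗ[ℤ] ℤ) (hM : ∀ i, h (M i) = 1)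
    {z : ι → ℤ} (hz : h z = 1) : ∑ i, scaledBary M z i = M.det := by
  have := congrArg h (sum_scaledBary_smul M z)
  rw [map_sum, map_smul, hz, smul_eq_mul, mul_one] at this
  rw [← this]
  exact Finset.sum_congr rfl fun i _ => by rw [map_smul, hM, smul_eq_mul, mul_one]

theorem scaledBary_updateRow_self (M : Matrix ι ι ℤ) (q z : ι → ℤ) (i : ι) :
    scaledBary (M.updateRow i q) z i = scaledBary M z i := by
  simp [scaledBary]

theorem scaledBary_updateRow_swap (M : Matrix ι ι ℤ) (q : ι → ℤ) {i j : ι} (h : j ≠ i) :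
    scaledBary (M.updateRow i q) (M i) j = - scaledBary M q j := by
  rw [scaledBary, scaledBary]
  have : (M.updateRow i q).updateRow j (M i)
      = ((M.updateRow j q)).submatrix (Equiv.swap i j) id := by
    ext a b
    rcases eq_or_ne a j with rfl | haj
    · simp [h.symm]
    · rcases eq_or_ne a i with rfl | hai
      · simp [h.symm]
      · simp [Equiv.swap_apply_of_ne_of_ne hai haj, haj, hai]
  rw [this, Matrix.det_permute]
  simp [Equiv.Perm.sign_swap h.symm]

/-- Expand `M.det • z` in the rows of `M`: after row `i` has become `q`, only the terms of rows `i`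
and `j` survive. All comparisons of ratios, and later the congruences modulo the determinant, come
from this identity. -/
theorem det_mul_scaledBary_updateRow (M : Matrix ι ι ℤ) (q z : ι → ℤ) {i j : ι} (h : j ≠ i) :
    M.det * scaledBary (M.updateRow i q) z j
      = scaledBary M q i * scaledBary M z j - scaledBary M z i * scaledBary M q j := by
  rw [← scaledBary_smul, ← sum_scaledBary_smul]
  refine (scaledBary_sum_smul _ (scaledBary M z) (fun l => M l) j).trans ?_
  rw [Finset.sum_eq_add_of_mem i j (Finset.mem_univ _) (Finset.mem_univ _) h.symm]
  · rw [scaledBary_updateRow_swap M q h]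
    have : scaledBary (M.updateRow i q) (M j) j = scaledBary M q i := by
      have := scaledBary_row_self (M.updateRow i q) j
      rwa [Matrix.updateRow_ne h] at this
    rw [this]; ring
  · intro l _ hl
    have := scaledBary_row_of_ne (M.updateRow i q) hl.2
    rw [Matrix.updateRow_ne hl.1] at this
    rw [this, mul_zero]

theorem eq_of_scaledBary_eq {M : Matrix ι ι ℤ} (hM : M.det ≠ 0) {z w : ι → ℤ}
    (h : ∀ i, scaledBary M z i = scaledBary M w i) : z = w := by
  have h1 := sum_scaledBary_smul M z
  simp only [h] at h1
  rw [sum_scaledBary_smul M w] at h1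
  exact (smul_right_injective _ hM h1).symm

open Classical in
/-- The dimension of the face of the simplex spanned by the rows of `M` whose relative interior
contains `z`, or `0` if `z` lies outside the simplex. -/
noncomputable def faceDim (M : Matrix ι ι ℤ) (z : ι → ℤ) : ℕ :=
  if ∀ i, 0 ≤ scaledBary M z i then (Finset.univ.filter fun i => 0 < scaledBary M z i).card - 1
  else 0

theorem faceDim_of_forall_pos {M : Matrix ι ι ℤ} {z : ι → ℤ} (h : ∀ i, 0 < scaledBary M z i) :
    faceDim M z = Fintype.card ι - 1 := by
  simp [faceDim, h, fun i => (h i).le]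

theorem nonneg_of_faceDim_pos {M : Matrix ι ι ℤ} {z : ι → ℤ} (h : 0 < faceDim M z) (i : ι) :
    0 ≤ scaledBary M z i := by
  by_contra hi
  rw [faceDim, if_neg fun H => hi (H i)] at h
  exact lt_irrefl _ h

theorem faceDim_pos_iff {M : Matrix ι ι ℤ} {z : ι → ℤ} : 0 < faceDim M z ↔
    (∀ i, 0 ≤ scaledBary M z i) ∧ ∃ i j, i ≠ j ∧ 0 < scaledBary M z i ∧ 0 < scaledBary M z j := by
  classical
  by_cases h : ∀ i, 0 ≤ scaledBary M z i
  · simp only [faceDim, h, implies_true, if_true, true_and]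
    rw [Nat.sub_pos_iff_lt, Finset.one_lt_card_iff]
    simp only [Finset.mem_filter, Finset.mem_univ, true_and]
    constructor
    · rintro ⟨a, b, ha, hb, hab⟩; exact ⟨a, b, hab, ha, hb⟩
    · rintro ⟨a, b, hab, ha, hb⟩; exact ⟨a, b, ha, hb, hab⟩
  · simp [faceDim, h]

theorem faceDim_row (M : Matrix ι ι ℤ) (i : ι) : faceDim M (M i) = 0 := by
  by_contra h
  obtain ⟨-, a, b, hab, ha, hb⟩ := faceDim_pos_iff.1 (Nat.pos_of_ne_zero h)
  rcases eq_or_ne a i with rfl | hai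
  · rw [scaledBary_row_of_ne M hab] at hb; exact lt_irrefl _ hb
  · rw [scaledBary_row_of_ne M hai.symm] at ha; exact lt_irrefl _ ha

theorem faceDim_updateRow_self (M : Matrix ι ι ℤ) (q : ι → ℤ) (i : ι) :
    faceDim (M.updateRow i q) q = 0 := by
  simpa using faceDim_row (M.updateRow i q) i

/-- A point of the simplex with at most one nonzero barycentric coordinate is a vertex. -/
theorem exists_eq_row_of_faceDim_eq_zero {M : Matrix ι ι ℤ} (hM : 0 < M.det)
    (h : (ι → ℤ) →ₗ[ℤ] ℤ) (hr : ∀ i, h (M i) = 1) {z : ι → ℤ} (hz : h z = 1)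
    (h0 : ∀ i, 0 ≤ scaledBary M z i) (hd : faceDim M z = 0) : ∃ i, z = M i := by
  have hs := sum_scaledBary M h hr hz
  obtain ⟨i, hi⟩ : ∃ i, 0 < scaledBary M z i := by
    by_contra! H
    have := Finset.sum_nonpos fun i (_ : i ∈ Finset.univ) => H i
    omega
  have hother : ∀ j, j ≠ i → scaledBary M z j = 0 := by
    intro j hj
    by_contra hne
    have : 0 < faceDim M z := faceDim_pos_iff.2
      ⟨h0, i, j, hj.symm, hi, lt_of_le_of_ne (h0 j) (Ne.symm hne)⟩
    omega
  rw [Fintype.sum_eq_single i hother] at hs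
  refine ⟨i, eq_of_scaledBary_eq hM.ne' fun j => ?_⟩
  rcases eq_or_ne j i with rfl | hj
  · rw [scaledBary_row_self, hs]
  · rw [scaledBary_row_of_ne M hj.symm, hother j hj]

/-- Membership in a piece of the subdivision: the ratio of `z` to `q` must be smallest at the
replaced vertex. Cross-multiplication avoids division where `q` has coordinate zero. -/
theorem faceDim_updateRow_le {M : Matrix ι ι ℤ} (hM : 0 < M.det) {q z : ι → ℤ} {i : ι}
    (hq : 0 < scaledBary M q i) :
    (∀ j, 0 ≤ scaledBary (M.updateRow i q) z j) ↔
      0 ≤ scaledBary M z i ∧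
      ∀ j, scaledBary M z i * scaledBary M q j ≤ scaledBary M z j * scaledBary M q i := by
  constructor
  · intro H
    refine ⟨by simpa [scaledBary_updateRow_self] using H i, fun j => ?_⟩
    rcases eq_or_ne j i with rfl | hj
    · exact le_rfl
    · have h1 := det_mul_scaledBary_updateRow M q z hj
      have h2 := mul_nonneg hM.le (H j)
      linarith
  · rintro ⟨h1, h2⟩ j
    rcases eq_or_ne j i with rfl | hj
    · rwa [scaledBary_updateRow_self]
    · have h3 := det_mul_scaledBary_updateRow M q z hj
      refine nonneg_of_mul_nonneg_right (a := M.det) ?_ hM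
      have := h2 j
      linarith

theorem scaledBary_updateRow_pos_iff {M : Matrix ι ι ℤ} (hM : 0 < M.det) {q z : ι → ℤ} {i j : ι}
    (hj : j ≠ i) : 0 < scaledBary (M.updateRow i q) z j ↔
      scaledBary M z i * scaledBary M q j < scaledBary M z j * scaledBary M q i := by
  rw [← mul_pos_iff_of_pos_left hM, det_mul_scaledBary_updateRow M q z hj, sub_pos, mul_comm
    (scaledBary M q i)]

open Classical in
/-- The indices at which the ratio of the barycentric coordinates of `z` to the positive
barycentric coordinates of `q` is minimal. -/
noncomputable def ratioArgmin (M : Matrix ι ι ℤ) (q z : ι → ℤ) : Finset ι :=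
  Finset.univ.filter fun i => 0 < scaledBary M q i ∧
    ∀ j, scaledBary M z i * scaledBary M q j ≤ scaledBary M z j * scaledBary M q i

theorem mem_ratioArgmin {M : Matrix ι ι ℤ} {q z : ι → ℤ} {i : ι} :
    i ∈ ratioArgmin M q z ↔ 0 < scaledBary M q i ∧
      ∀ j, scaledBary M z i * scaledBary M q j ≤ scaledBary M z j * scaledBary M q i := by
  simp [ratioArgmin]

theorem ratioArgmin_nonempty {M : Matrix ι ι ℤ} {q z : ι → ℤ}
    (hq : ∀ i, 0 ≤ scaledBary M q i) (hz : ∀ i, 0 ≤ scaledBary M z i)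
    (hq' : ∃ i, 0 < scaledBary M q i) :
    (ratioArgmin M q z).Nonempty := by
  classical
  obtain ⟨i₀, hi₀⟩ := hq'
  obtain ⟨i, hi, hmin⟩ := Finset.exists_min_image
    (Finset.univ.filter fun i => 0 < scaledBary M q i)
    (fun i => (scaledBary M z i : ℚ) / scaledBary M q i) ⟨i₀, by simpa using hi₀⟩
  simp only [Finset.mem_filter, Finset.mem_univ, true_and] at hi hmin
  refine ⟨i, mem_ratioArgmin.2 ⟨hi, fun j => ?_⟩⟩
  rcases (hq j).eq_or_lt with h0 | hj
  · rw [← h0, mul_zero]; exact mul_nonneg (hz j) hi.le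
  · have := hmin j hj
    rw [div_le_div_iff₀ (by exact_mod_cast hi) (by exact_mod_cast hj)] at this
    exact_mod_cast this

theorem faceDim_updateRow_of_notMem {M : Matrix ι ι ℤ} (hM : 0 < M.det) {q z : ι → ℤ} {i : ι}
    (hq : 0 < scaledBary M q i) (hi : i ∉ ratioArgmin M q z) :
    faceDim (M.updateRow i q) z = 0 := by
  rw [faceDim, if_neg]
  rw [faceDim_updateRow_le hM hq]
  exact fun H => hi (mem_ratioArgmin.2 ⟨hq, H.2⟩)

/-- Coordinates at minimizing indices vanish in the piece, except the one at `i`, which now belongs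
to `q`. That extra coordinate cancels the `- 1` in the dimension. -/
theorem faceDim_updateRow_of_mem {M : Matrix ι ι ℤ} (hM : 0 < M.det) {q z : ι → ℤ} {i : ι}
    (hq0 : ∀ i, 0 ≤ scaledBary M q i)
    (hz : 0 < scaledBary M z i) (hi : i ∈ ratioArgmin M q z) :
    faceDim (M.updateRow i q) z =
      ((Finset.univ.filter fun i => 0 < scaledBary M z i) \ ratioArgmin M q z).card := by
  classical
  obtain ⟨hq, hmin⟩ := mem_ratioArgmin.1 hi
  rw [faceDim, if_pos ((faceDim_updateRow_le hM hq).2 ⟨hz.le, hmin⟩)]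
  have : (Finset.univ.filter fun j => 0 < scaledBary (M.updateRow i q) z j) =
      insert i ((Finset.univ.filter fun i => 0 < scaledBary M z i) \ ratioArgmin M q z) := by
    ext j
    simp only [Finset.mem_filter, Finset.mem_univ, true_and, Finset.mem_insert, Finset.mem_sdiff]
    rcases eq_or_ne j i with rfl | hj
    · simpa [scaledBary_updateRow_self] using hz
    · rw [scaledBary_updateRow_pos_iff hM hj]
      simp only [hj, false_or]
      constructor
      · intro hlt
        refine ⟨?_, fun hmem => ?_⟩
        · exact pos_of_mul_pos_left (lt_of_le_of_lt (mul_nonneg hz.le (hq0 j)) hlt) hq.le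
        · exact absurd ((mem_ratioArgmin.1 hmem).2 i) (not_le.2 hlt)
      · rintro ⟨hzj, hmem⟩
        refine lt_of_le_of_ne (hmin j) fun heq => hmem (mem_ratioArgmin.2 ?_)
        have hqj : 0 < scaledBary M q j := by
          refine lt_of_le_of_ne (hq0 j) fun h0 => ?_
          rw [← h0, mul_zero] at heq
          exact (mul_pos hzj hq).ne heq
        refine ⟨hqj, fun l => ?_⟩
        refine le_of_mul_le_mul_right ?_ hq
        calc scaledBary M z j * scaledBary M q l * scaledBary M q i
            = scaledBary M z i * scaledBary M q l * scaledBary M q j := by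
              rw [mul_right_comm, ← heq]; ring
          _ ≤ scaledBary M z l * scaledBary M q i * scaledBary M q j :=
              mul_le_mul_of_nonneg_right (hmin l) hqj.le
          _ = _ := by ring
  rw [this, Finset.card_insert_of_notMem (by simp [hi])]
  simp

theorem faceDim_updateRow_of_eq_zero {M : Matrix ι ι ℤ} (hM : 0 < M.det) {q z : ι → ℤ} {i : ι}
    (hz0 : ∀ i, 0 ≤ scaledBary M z i)
    (hz : scaledBary M z i = 0) (hi : i ∈ ratioArgmin M q z) :
    faceDim (M.updateRow i q) z = faceDim M z := by
  classical
  obtain ⟨hq, hmin⟩ := mem_ratioArgmin.1 hi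
  rw [faceDim, if_pos ((faceDim_updateRow_le hM hq).2 ⟨hz.ge, hmin⟩), faceDim, if_pos hz0]
  congr 2
  ext j
  simp only [Finset.mem_filter, Finset.mem_univ, true_and]
  rcases eq_or_ne j i with rfl | hj
  · rw [scaledBary_updateRow_self]
  · rw [scaledBary_updateRow_pos_iff hM hj, hz, zero_mul]
    exact ⟨fun H => pos_of_mul_pos_left H hq.le, fun H => mul_pos H hq⟩

/-- The face dimensions of `z` in the pieces of the star subdivision at `q`. -/
theorem sum_faceDim_updateRow {M : Matrix ι ι ℤ} (hM : 0 < M.det) {q z : ι → ℤ}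
    (hq0 : ∀ i, 0 ≤ scaledBary M q i) (hz : ∀ i, 0 < scaledBary M z i) :
    ∑ i with 0 < scaledBary M q i, faceDim (M.updateRow i q) z =
      (ratioArgmin M q z).card * (Fintype.card ι - (ratioArgmin M q z).card) := by
  classical
  rw [← Finset.sum_subset (s₁ := ratioArgmin M q z)]
  · rw [Finset.sum_congr rfl fun i hi => faceDim_updateRow_of_mem hM hq0 (hz i) hi]
    simp [hz, Finset.card_sdiff]
  · intro i hi
    simpa using (mem_ratioArgmin.1 hi).1
  · intro i hi hi'
    exact faceDim_updateRow_of_notMem hM (by simpa using hi) hi'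

theorem faceDim_le_sum_updateRow {M : Matrix ι ι ℤ} (hM : 0 < M.det)
    (h : (ι → ℤ) →ₗ[ℤ] ℤ) (hr : ∀ i, h (M i) = 1) {q z : ι → ℤ} (hq : h q = 1) (hz : h z = 1)
    (hq0 : ∀ i, 0 ≤ scaledBary M q i) (hne : z ≠ q) :
    faceDim M z ≤ ∑ i with 0 < scaledBary M q i, faceDim (M.updateRow i q) z := by
  classical
  by_cases hz0 : ∀ i, 0 ≤ scaledBary M z i
  swap
  · simp [faceDim, hz0]
  have hqpos : ∃ i, 0 < scaledBary M q i := by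
    by_contra! H
    have := Finset.sum_nonpos fun i (_ : i ∈ Finset.univ) => H i
    have := sum_scaledBary M h hr hq
    omega
  obtain ⟨i, hi⟩ := ratioArgmin_nonempty hq0 hz0 hqpos
  obtain ⟨hqi, hmin⟩ := mem_ratioArgmin.1 hi
  -- If the minimal ratio is zero, one piece already keeps the face dimension. Otherwise each of the
  -- `|S|` minimizing pieces contributes `|Z \ S|`, and `|S| * |Z \ S| ≥ |S| + |Z \ S| - 1` when
  -- both factors are positive.
  rcases (hz0 i).eq_or_lt with hzi | hzi
  · rw [← faceDim_updateRow_of_eq_zero hM hz0 hzi.symm hi]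
    exact Finset.single_le_sum (f := fun i => faceDim (M.updateRow i q) z)
      (fun _ _ => Nat.zero_le _) (by simpa using hqi)
  · set S := ratioArgmin M q z
    set Z := Finset.univ.filter fun i => 0 < scaledBary M z i
    have hSz : ∀ j ∈ S, 0 < scaledBary M z j := by
      intro j hj
      have := hmin j
      exact pos_of_mul_pos_left (lt_of_lt_of_le (mul_pos hzi (mem_ratioArgmin.1 hj).1) this) hqi.le
    have hSZ : S ⊆ Z := fun j hj => by simpa [Z] using hSz j hj
    have hsum : S.card * (Z \ S).card ≤
        ∑ i with 0 < scaledBary M q i, faceDim (M.updateRow i q) z := by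
      rw [← smul_eq_mul, ← Finset.sum_const,
        ← Finset.sum_congr rfl fun i hi => faceDim_updateRow_of_mem hM hq0 (hSz i hi) hi]
      exact Finset.sum_le_sum_of_subset fun j hj => by simpa using (mem_ratioArgmin.1 hj).1
    -- If every positive coordinate were minimizing, `z` and `q` would be proportional, hence equal
    -- since their coordinates have the same sum.
    have hne' : (Z \ S).Nonempty := by
      rw [Finset.nonempty_iff_ne_empty, Ne, Finset.sdiff_eq_empty_iff_subset]
      intro hZS
      apply hne
      have hprop : ∀ j, scaledBary M z i * scaledBary M q j
          = scaledBary M z j * scaledBary M q i := by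
        intro j
        by_cases hj : j ∈ S
        · exact le_antisymm (hmin j) ((mem_ratioArgmin.1 hj).2 i)
        · have hzj : scaledBary M z j = 0 := by
            have : j ∉ Z := fun H => hj (hZS H)
            simp only [Z, Finset.mem_filter, Finset.mem_univ, true_and, not_lt] at this
            exact le_antisymm this (hz0 j)
          have h1 := hmin j
          rw [hzj, zero_mul] at h1 ⊢
          exact le_antisymm h1 (mul_nonneg hzi.le (hq0 j))
      have hs1 := sum_scaledBary M h hr hq
      have hs2 := sum_scaledBary M h hr hz
      have hs3 : scaledBary M z i * M.det = M.det * scaledBary M q i := by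
        rw [← hs1, Finset.mul_sum, hs1, ← hs2, Finset.sum_mul]
        exact Finset.sum_congr rfl fun j _ => hprop j
      have hs4 : scaledBary M z i = scaledBary M q i := by
        rw [mul_comm] at hs3
        exact mul_left_cancel₀ hM.ne' hs3
      refine eq_of_scaledBary_eq hM.ne' fun j => ?_
      have := hprop j
      rw [hs4, mul_comm] at this
      exact (mul_right_cancel₀ hqi.ne' this).symm
    refine le_trans ?_ hsum
    rw [faceDim, if_pos hz0]
    have hc : (Z \ S).card + S.card = Z.card := Finset.card_sdiff_add_card_eq_card hSZ
    have h1 : 1 ≤ S.card := Finset.card_pos.2 ⟨i, hi⟩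
    have h2 : 1 ≤ (Z \ S).card := Finset.card_pos.2 hne'
    change Z.card - 1 ≤ _
    rw [← hc]
    obtain ⟨a, ha⟩ := Nat.exists_eq_add_of_le h1
    obtain ⟨b, hb⟩ := Nat.exists_eq_add_of_le h2
    rw [ha, hb]
    have : 1 + b + (1 + a) - 1 = a + b + 1 := by omega
    rw [this]
    nlinarith [Nat.zero_le (a * b)]

end Barycentric

/-! ### The volume bound and its equality case. -/

section Subdivision

theorem apply_updateRow_eq_one {ι : Type*} [DecidableEq ι] {M : Matrix ι ι ℤ} {h : (ι → ℤ) →ₗ[ℤ] ℤ} (hr : ∀ i, h (M i) = 1)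
    {q : ι → ℤ} (hq : h q = 1) (i j : ι) : h (M.updateRow i q j) = 1 := by
  rcases eq_or_ne j i with rfl | hj
  · rwa [Matrix.updateRow_self]
  · rw [Matrix.updateRow_ne hj, hr]

variable {ι : Type*} [Fintype ι] [DecidableEq ι]

theorem sum_scaledBary_filter_pos {M : Matrix ι ι ℤ} {h : (ι → ℤ) →ₗ[ℤ] ℤ}
    (hr : ∀ i, h (M i) = 1) {q : ι → ℤ} (hq : h q = 1) (hq0 : ∀ i, 0 ≤ scaledBary M q i) :
    ∑ i with 0 < scaledBary M q i, scaledBary M q i = M.det := by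
  rw [← sum_scaledBary M h hr hq]
  refine Finset.sum_subset (Finset.subset_univ _) fun i _ hi => ?_
  simp only [Finset.mem_filter, Finset.mem_univ, true_and, not_lt] at hi
  exact le_antisymm hi (hq0 i)

/-- Replacing a simplex by the pieces of its star subdivision at `q` does not decrease the total
face dimension of the points other than `q`. -/
theorem sum_faceDim_le {M : Matrix ι ι ℤ} (hM : 0 < M.det) {h : (ι → ℤ) →ₗ[ℤ] ℤ}
    (hr : ∀ i, h (M i) = 1) {P : Finset (ι → ℤ)} (hP : ∀ z ∈ P, h z = 1) {q : ι → ℤ}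
    (hq : q ∈ P) (hq0 : ∀ i, 0 ≤ scaledBary M q i) :
    ∑ z ∈ P.erase q, faceDim M z ≤
      ∑ z ∈ P.erase q, ∑ i with 0 < scaledBary M q i, faceDim (M.updateRow i q) z :=
  Finset.sum_le_sum fun z hz =>
    faceDim_le_sum_updateRow hM h hr (hP q hq) (hP z (Finset.mem_of_mem_erase hz)) hq0
      (Finset.ne_of_mem_erase hz)

/-- The number of pieces pays for the face dimension that `q` loses on becoming a vertex. -/
theorem sum_one_add_sum_faceDim (M : Matrix ι ι ℤ) {P : Finset (ι → ℤ)} {q : ι → ℤ} (hq : q ∈ P)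
    (hd : 0 < faceDim M q) :
    ∑ i with 0 < scaledBary M q i, (1 + ∑ z ∈ P, faceDim (M.updateRow i q) z) =
      1 + faceDim M q +
        ∑ z ∈ P.erase q, ∑ i with 0 < scaledBary M q i, faceDim (M.updateRow i q) z := by
  have hcard : (Finset.univ.filter fun i => 0 < scaledBary M q i).card = 1 + faceDim M q := by
    have h0 := nonneg_of_faceDim_pos hd
    rw [faceDim, if_pos h0] at hd ⊢
    have : (Finset.univ.filter fun i => 0 < scaledBary M q i).card ≠ 0 := by
      intro H
      simp [H] at hd
    convert (Nat.add_sub_cancel' (Nat.pos_of_ne_zero this)).symm using 1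
  rw [Finset.sum_add_distrib, Finset.sum_const, smul_eq_mul, mul_one, hcard, Finset.sum_comm,
    ← Finset.add_sum_erase P _ hq]
  simp [faceDim_updateRow_self]

theorem one_add_sum_faceDim_le_det {h : (ι → ℤ) →ₗ[ℤ] ℤ} {P : Finset (ι → ℤ)}
    (hP : ∀ z ∈ P, h z = 1) (M : Matrix ι ι ℤ) (hM : 0 < M.det) (hr : ∀ i, h (M i) = 1) :
    ((1 + ∑ z ∈ P, faceDim M z : ℕ) : ℤ) ≤ M.det := by
  induction hn : M.det.toNat using Nat.strong_induction_on generalizing M with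
  | _ n ih =>
  by_cases hall : ∀ z ∈ P, faceDim M z = 0
  · rw [Finset.sum_eq_zero hall]
    exact_mod_cast hM
  push Not at hall
  obtain ⟨q, hq, hd⟩ := hall
  have hd := Nat.pos_of_ne_zero hd
  obtain ⟨hq0, a, b, hab, ha, hb⟩ := faceDim_pos_iff.1 hd
  have hsum := sum_scaledBary_filter_pos hr (hP q hq) hq0
  have hlt : ∀ i, scaledBary M q i < M.det := by
    intro i
    obtain ⟨j, hij, hj⟩ : ∃ j, i ≠ j ∧ 0 < scaledBary M q j := by
      rcases eq_or_ne i a with rfl | hia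
      · exact ⟨b, hab, hb⟩
      · exact ⟨a, hia, ha⟩
    have h1 := Finset.add_le_sum (fun i _ => hq0 i) (Finset.mem_univ i) (Finset.mem_univ j) hij
    rw [sum_scaledBary M h hr (hP q hq)] at h1
    omega
  have key : ∑ i with 0 < scaledBary M q i,
      ((1 + ∑ z ∈ P, faceDim (M.updateRow i q) z : ℕ) : ℤ) ≤ M.det := by
    rw [← hsum]
    refine Finset.sum_le_sum fun i hi => ?_
    have hi : 0 < scaledBary M q i := by simpa using hi
    refine ih (scaledBary M q i).toNat ?_ (M.updateRow i q) hi
      (apply_updateRow_eq_one hr (hP q hq) i) rfl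
    have := hlt i
    omega
  rw [← Nat.cast_sum, sum_one_add_sum_faceDim M hq hd] at key
  refine le_trans (Int.ofNat_le.2 ?_) key
  rw [← Finset.add_sum_erase P _ hq]
  have := sum_faceDim_le hM hr hP hq hq0
  omega

/-- The simplex spanned by the rows of `M` has the least volume allowed by the points of `P`. -/
def IsTight (M : Matrix ι ι ℤ) (P : Finset (ι → ℤ)) : Prop :=
  M.det = ((1 + ∑ z ∈ P, faceDim M z : ℕ) : ℤ)

theorem IsTight.det_pos {M : Matrix ι ι ℤ} {P : Finset (ι → ℤ)} (ht : IsTight M P) :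
    0 < M.det := by
  rw [ht]; positivity

/-- Equality in a sum of inequalities forces equality in each: in the volume bound for every piece,
and in the face-dimension bound for every point other than `q`. -/
theorem IsTight.updateRow_and {M : Matrix ι ι ℤ} {P : Finset (ι → ℤ)} (ht : IsTight M P)
    {h : (ι → ℤ) →ₗ[ℤ] ℤ} (hP : ∀ z ∈ P, h z = 1) (hr : ∀ i, h (M i) = 1)
    {q : ι → ℤ} (hq : q ∈ P) (hd : 0 < faceDim M q) :
    (∀ i, 0 < scaledBary M q i → IsTight (M.updateRow i q) P) ∧
    ∀ z ∈ P, z ≠ q →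
      faceDim M z = ∑ i with 0 < scaledBary M q i, faceDim (M.updateRow i q) z := by
  have hM := ht.det_pos
  have hq0 := nonneg_of_faceDim_pos hd
  have hsum := sum_scaledBary_filter_pos hr (hP q hq) hq0
  have hle : ∀ i ∈ Finset.univ.filter (fun i => 0 < scaledBary M q i),
      ((1 + ∑ z ∈ P, faceDim (M.updateRow i q) z : ℕ) : ℤ) ≤ scaledBary M q i := by
    intro i hi
    have hi : 0 < scaledBary M q i := by simpa using hi
    exact one_add_sum_faceDim_le_det hP _ hi
      (apply_updateRow_eq_one hr (hP q hq) i)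
  have hle' : ∀ z ∈ P.erase q,
      faceDim M z ≤ ∑ i with 0 < scaledBary M q i, faceDim (M.updateRow i q) z := fun z hz =>
    faceDim_le_sum_updateRow hM h hr (hP q hq) (hP z (Finset.mem_of_mem_erase hz)) hq0
      (Finset.ne_of_mem_erase hz)
  have h1 := Finset.sum_le_sum hle
  have h2 := Finset.sum_le_sum hle'
  have h3 := h1
  rw [hsum, ← Nat.cast_sum, sum_one_add_sum_faceDim M hq hd, ht] at h3
  have h3 := Int.ofNat_le.1 h3
  rw [← Finset.add_sum_erase P _ hq] at h3
  have h4 := le_antisymm h2 (by omega)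
  refine ⟨fun i hi => ?_, fun z hz hne => ?_⟩
  · have h5 : ∑ i with 0 < scaledBary M q i,
        ((1 + ∑ z ∈ P, faceDim (M.updateRow i q) z : ℕ) : ℤ) =
        ∑ i with 0 < scaledBary M q i, scaledBary M q i := by
      rw [hsum, ← Nat.cast_sum, sum_one_add_sum_faceDim M hq hd, ht,
        ← Finset.add_sum_erase P _ hq, ← h4, add_assoc]
    exact ((Finset.sum_eq_sum_iff_of_le hle).1 h5 i (by simpa using hi)).symm
  · exact (Finset.sum_eq_sum_iff_of_le hle').1 h4 z (Finset.mem_erase.2 ⟨hne, hz⟩)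

/-- In a tight simplex there is a point at lattice distance one from a facet that contains no
point of `P` other than vertices. -/
theorem IsTight.exists_scaledBary_eq_one {M : Matrix ι ι ℤ} {P : Finset (ι → ℤ)}
    (ht : IsTight M P) {h : (ι → ℤ) →ₗ[ℤ] ℤ} (hP : ∀ z ∈ P, h z = 1) (hr : ∀ i, h (M i) = 1)
    (o : ι) (hne : ∃ z ∈ P, 0 < faceDim M z)
    (hpos : ∀ z ∈ P, 0 < faceDim M z → 0 < scaledBary M z o) :
    ∃ s ∈ P, 0 < faceDim M s ∧ scaledBary M s o = 1 := by
  classical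
  have hM := ht.det_pos
  -- For `s` nearest to the facet, the piece with `s` in place of `o` has determinant `scaledBary M
  -- s o`. It is tight, so it suffices that no marked point has positive face dimension in it.
  obtain ⟨s, hs, hmin⟩ := Finset.exists_min_image (P.filter fun z => 0 < faceDim M z)
    (fun z => scaledBary M z o) (by
      obtain ⟨z, hz, hd⟩ := hne
      exact ⟨z, Finset.mem_filter.2 ⟨hz, hd⟩⟩)
  obtain ⟨hsP, hsd⟩ := Finset.mem_filter.1 hs
  have hso := hpos s hsP hsd
  refine ⟨s, hsP, hsd, ?_⟩
  have ht' : scaledBary M s o = _ := (ht.updateRow_and hP hr hsP hsd).1 o hso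
  rw [ht', Finset.sum_eq_zero, add_zero, Nat.cast_one]
  intro z hz
  by_contra hzd
  have hzd := Nat.pos_of_ne_zero hzd
  have hr' := apply_updateRow_eq_one hr (hP s hsP) o
  have hz0 := nonneg_of_faceDim_pos hzd
  have hz1 := (faceDim_updateRow_le hM hso).1 hz0
  have hsum := sum_scaledBary _ h hr' (hP z hz)
  rw [show (M.updateRow o s).det = scaledBary M s o from rfl] at hsum
  have hle : scaledBary M z o ≤ scaledBary M s o := by
    rw [← hsum, ← scaledBary_updateRow_self M s z o]
    exact Finset.single_le_sum (fun i _ => hz0 i) (Finset.mem_univ o)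
  have hs0 := nonneg_of_faceDim_pos hsd
  have hMz0 : ∀ j, 0 ≤ scaledBary M z j := fun j =>
    nonneg_of_mul_nonneg_left ((mul_nonneg hz1.1 (hs0 j)).trans (hz1.2 j)) hso
  rcases Nat.eq_zero_or_pos (faceDim M z) with hd0 | hdpos
  · obtain ⟨j, rfl⟩ := exists_eq_row_of_faceDim_eq_zero hM h hr (hP z hz) hMz0 hd0
    rcases eq_or_ne j o with rfl | hj
    · rw [scaledBary_row_self] at hle
      have h1 := sum_scaledBary M h hr (hP s hsP)
      obtain ⟨-, a, b, hab, ha, hb⟩ := faceDim_pos_iff.1 hsd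
      obtain ⟨l, hl, hl0⟩ : ∃ l, j ≠ l ∧ 0 < scaledBary M s l := by
        rcases eq_or_ne j a with rfl | hia
        · exact ⟨b, hab, hb⟩
        · exact ⟨a, hia, ha⟩
      have h2 := Finset.add_le_sum (fun i _ => hs0 i) (Finset.mem_univ j) (Finset.mem_univ l) hl
      omega
    · have := faceDim_row (M.updateRow o s) j
      rw [Matrix.updateRow_ne hj] at this
      omega
  -- Minimality puts the whole weight of `z` in the piece on the vertex `s`, which contradicts
  -- positive face dimension.
  · have heq : scaledBary M z o = scaledBary M s o :=
      le_antisymm hle (hmin z (Finset.mem_filter.2 ⟨hz, hdpos⟩))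
    have hzero : ∀ j, j ≠ o → scaledBary (M.updateRow o s) z j = 0 := by
      intro j hj
      have h2 := Finset.add_le_sum (fun i _ => hz0 i) (Finset.mem_univ o) (Finset.mem_univ j) hj.symm
      rw [hsum, scaledBary_updateRow_self, heq] at h2
      have := hz0 j
      omega
    obtain ⟨-, a, b, hab, ha, hb⟩ := faceDim_pos_iff.1 hzd
    rcases eq_or_ne a o with rfl | hao
    · rw [hzero b hab.symm] at hb; exact lt_irrefl _ hb
    · rw [hzero a hao] at ha; exact lt_irrefl _ ha

end Subdivision

/-! ### Arithmetic of the coordinates of a point next to a facet. -/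

section Weights

variable {ι : Type*} [Fintype ι] [DecidableEq ι]

/-- The shape of the scaled barycentric coordinates `a` of a lattice point next to the facet
opposite to the vertex `o` in a tight clean simplex. -/
theorem weights_eq_of_ratioArgmin_card {d k N : ℤ} (hd : 3 ≤ d) (hι : (Fintype.card ι : ℤ) = d + 1)
    (hN : N = d * k + 1) {A : Finset (ι → ℤ)} (hpos : ∀ z ∈ A, ∀ i, 0 < z i)
    (hsum : ∀ z ∈ A, ∑ i, z i = N)
    (hcard : ∀ q ∈ A, ∀ z ∈ A, z ≠ q →
      ((Finset.univ.filter fun i => ∀ j, z i * q j ≤ z j * q i).card : ℤ) = 1 ∨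
      ((Finset.univ.filter fun i => ∀ j, z i * q j ≤ z j * q i).card : ℤ) = d)
    {a : ι → ℤ} (haA : a ∈ A) {o : ι} (hao : a o = 1)
    (hdvd : ∀ z ∈ A, ∀ l, N ∣ z o * a l - z l)
    (hstep : ∀ i, i ≠ o → 1 < a i →
      ∃ s ∈ A, a i * s o - s i = N ∧ ∀ l, s i * a l ≤ s l * a i) :
    (∀ i, i ≠ o → a i = k) ∨ ∃ j, ∀ i, i ≠ j → a i = 1 := by
  have hapos := hpos a haA
  have hNpos : 0 < N := by
    rw [← hsum a haA]
    exact Finset.sum_pos (fun i _ => hapos i) ⟨o, Finset.mem_univ o⟩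
  -- the integer parts of the multiples of `a`
  have hfloor : ∀ z ∈ A, ∃ f : ι → ℤ, (∀ l, z l = z o * a l - N * f l) ∧ (∀ l, 0 ≤ f l) ∧
      f o = 0 ∧ z o = 1 + ∑ l, f l := by
    intro z hz
    choose f hf using hdvd z hz
    have hfo : f o = 0 := by
      have := hf o
      rw [hao, mul_one, sub_self] at this
      exact (mul_eq_zero.1 this.symm).resolve_left hNpos.ne'
    refine ⟨f, fun l => by have := hf l; omega, fun l => ?_, hfo, ?_⟩
    · by_contra! hneg
      have h1 : z l ≤ N := by
        rw [← hsum z hz]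
        exact Finset.single_le_sum (fun i _ => (hpos z hz i).le) (Finset.mem_univ l)
      have h2 := mul_pos (hpos z hz o) (hapos l)
      have h3 := hf l
      nlinarith
    · have h1 : ∑ l, (z o * a l - z l) = ∑ l, N * f l := Finset.sum_congr rfl fun l _ => hf l
      rw [Finset.sum_sub_distrib, ← Finset.mul_sum, ← Finset.mul_sum, hsum a haA, hsum z hz] at h1
      have : N * (z o - 1 - ∑ l, f l) = 0 := by linarith
      have := (mul_eq_zero.1 this).resolve_left hNpos.ne'
      omega
  -- The ratio of `a` to `z` is minimal exactly where `f` vanishes, so `f` has either one zero, at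
  -- `o`, or `d` zeros.
  have htype : ∀ z ∈ A, z ≠ a → ∀ f : ι → ℤ, (∀ l, z l = z o * a l - N * f l) → (∀ l, 0 ≤ f l) →
      f o = 0 → (∀ l, l ≠ o → 1 ≤ f l) ∨ ∀ i, f i ≠ 0 → ∀ l, l ≠ i → f l = 0 := by
    intro z hz hza f hf hf0 hfo
    have heq : (Finset.univ.filter fun i => ∀ j, a i * z j ≤ a j * z i)
        = Finset.univ.filter fun i => f i = 0 := by
      ext l
      simp only [Finset.mem_filter, Finset.mem_univ, true_and]
      constructor
      · intro H
        have := H o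
        rw [hao, one_mul, hf l] at this
        have h1 := hf0 l
        nlinarith
      · intro H j
        have h1 := mul_nonneg hNpos.le (mul_nonneg (hapos l).le (hf0 j))
        rw [hf l, hf j, H]
        linarith
    have hc := hcard z hz a haA hza.symm
    rw [heq] at hc
    rcases hc with hc | hc
    · left
      intro l hl
      by_contra hlt
      have h0 : f l = 0 := by have := hf0 l; omega
      have : 1 < (Finset.univ.filter fun i => f i = 0).card :=
        Finset.one_lt_card.2 ⟨l, by simpa using h0, o, by simpa using hfo, hl⟩
      omega
    · right
      intro i hi l hl
      by_contra hl0
      have h1 := Finset.card_filter_add_card_filter_not (s := (Finset.univ : Finset ι))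
        (p := fun i => f i = 0)
      rw [Finset.card_univ] at h1
      have : 1 < (Finset.univ.filter fun i => ¬ f i = 0).card :=
        Finset.one_lt_card.2 ⟨l, by simpa using hl0, i, by simpa using hi, hl⟩
      omega
  -- The point from `hstep` has `f i = 1`. Either `f` is positive off `o`, or it is supported at `i`
  -- alone and the point is `2a - N e_i`.
  have hminor : ∀ i, i ≠ o → 1 < a i →
      (∃ s ∈ A, ∃ f : ι → ℤ, (∀ l, s l = s o * a l - N * f l) ∧ s o = 1 + ∑ l, f l ∧ f o = 0 ∧
        f i = 1 ∧ (∀ l, l ≠ o → 1 ≤ f l) ∧ ∀ l, f l * a i ≤ a l) ∨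
      ∃ y ∈ A, y o = 2 ∧ y i = 2 * a i - N ∧ ∀ l, l ≠ i → y l = 2 * a l := by
    intro i hio hai
    obtain ⟨s, hs, hsi, hsmin⟩ := hstep i hio hai
    obtain ⟨f, hf, hf0, hfo, hfs⟩ := hfloor s hs
    have hfi : f i = 1 := by
      have : N * (f i - 1) = 0 := by have := hf i; linarith
      have := (mul_eq_zero.1 this).resolve_left hNpos.ne'
      omega
    have hsa : s ≠ a := by
      rintro rfl
      rw [hao] at hsi
      omega
    rcases htype s hs hsa f hf hf0 hfo with h1 | h1
    · refine Or.inl ⟨s, hs, f, hf, hfs, hfo, hfi, h1, fun l => ?_⟩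
      have := hsmin l
      rw [hf i, hf l, hfi] at this
      have : N * (f l * a i) ≤ N * a l := by linarith
      exact le_of_mul_le_mul_left this hNpos
    · have h2 := h1 i (by omega)
      have hso : s o = 2 := by
        rw [hfs, Fintype.sum_eq_single i h2, hfi]; rfl
      refine Or.inr ⟨s, hs, hso, ?_, fun l hl => ?_⟩
      · rw [hf i, hso, hfi, mul_one]
      · rw [hf l, hso, h2 l hl, mul_zero, sub_zero]
  have hge : ∀ i, i ≠ o →
      (¬ ∃ y ∈ A, y o = 2 ∧ y i = 2 * a i - N ∧ ∀ l, l ≠ i → y l = 2 * a l) →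
      ∀ l, l ≠ o → a i ≤ a l := by
    intro i hio hno l hl
    rcases (show 1 ≤ a i from hapos i).eq_or_lt with h1 | h1
    · rw [← h1]; exact hapos l
    · obtain ⟨s, -, f, -, -, -, -, h2, h3⟩ := (hminor i hio h1).resolve_right hno
      have := h2 l hl
      have := h3 l
      nlinarith
  -- Without a point `2a - N e_m`, `hge` makes all coordinates of `a` off `o` equal, and `1 + d * a
  -- i = d * k + 1`.
  by_cases hex : ∃ m, m ≠ o ∧ ∃ y ∈ A, y o = 2 ∧ y m = 2 * a m - N ∧ ∀ l, l ≠ m → y l = 2 * a l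
  swap
  · left
    intro i hi
    have hall : ∀ l ∈ Finset.univ.erase o, a l = a i := by
      intro l hl
      have hl := Finset.ne_of_mem_erase hl
      exact le_antisymm (hge l hl (fun H => hex ⟨l, hl, H⟩) i hi)
        (hge i hi (fun H => hex ⟨i, hi, H⟩) l hl)
    have h1 := hsum a haA
    rw [← Finset.add_sum_erase _ _ (Finset.mem_univ o), Finset.sum_congr rfl hall,
      Finset.sum_const, Finset.card_erase_of_mem (Finset.mem_univ o), Finset.card_univ,
      nsmul_eq_mul, hao, hN] at h1
    have h2 : ((Fintype.card ι - 1 : ℕ) : ℤ) = d := by omega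
    rw [h2] at h1
    have : d * (a i - k) = 0 := by linarith
    have := (mul_eq_zero.1 this).resolve_left (by omega)
    omega
  obtain ⟨m, hmo, y, hy, hyo, hym, hyl⟩ := hex
  right
  refine ⟨m, ?_⟩
  by_contra hne
  push Not at hne
  obtain ⟨i, him, hai⟩ := hne
  have hio : i ≠ o := by rintro rfl; exact hai hao
  have hai : 1 < a i := lt_of_le_of_ne (hapos i) (Ne.symm hai)
  -- Two such indices would give `2 * a l > N` and `2 * a m > N`, against `a l + a m ≤ N`.
  have hno : ∀ l, l ≠ m →
      ¬ ∃ y ∈ A, y o = 2 ∧ y l = 2 * a l - N ∧ ∀ j, j ≠ l → y j = 2 * a j := by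
    rintro l hl ⟨w, hw, -, hwl, -⟩
    have h1 := hpos w hw l
    have h2 := hpos y hy m
    have h3 := Finset.add_le_sum (f := a) (fun i _ => (hapos i).le) (Finset.mem_univ l)
      (Finset.mem_univ m) hl
    rw [hsum a haA] at h3
    omega
  have hb : ∀ l, l ≠ o → l ≠ m → a l = a i := fun l hl hlm =>
    le_antisymm (hge l hl (hno l hlm) i hio) (hge i hio (hno i him) l hl)
  obtain ⟨s, hs, f, hf, hfs, hfo, hfi, hf1, hfa⟩ := (hminor i hio hai).resolve_right (hno i him)
  have hfl : ∀ l, l ≠ o → l ≠ m → f l = 1 := by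
    intro l hl hlm
    have h1 := hfa l
    rw [hb l hl hlm] at h1
    have h2 := hf1 l hl
    nlinarith
  have hcompl : ((Finset.univ.erase o).erase m).card = (d - 1 : ℤ) := by
    rw [Finset.card_erase_of_mem (Finset.mem_erase.2 ⟨hmo, Finset.mem_univ m⟩),
      Finset.card_erase_of_mem (Finset.mem_univ o), Finset.card_univ]
    omega
  have hsplit : ∀ g : ι → ℤ, (∀ l, l ≠ o → l ≠ m → g l = g i) →
      ∑ l, g l = g o + g m + (d - 1) * g i := by
    intro g hg
    rw [← Finset.add_sum_erase _ _ (Finset.mem_univ o),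
      ← Finset.add_sum_erase _ _ (Finset.mem_erase.2 ⟨hmo, Finset.mem_univ m⟩),
      Finset.sum_congr rfl (g := fun _ => g i), Finset.sum_const, nsmul_eq_mul, hcompl, add_assoc]
    intro l hl
    simp only [Finset.mem_erase] at hl
    exact hg l hl.2.1 hl.1
  have hNeq := hsplit a hb
  rw [hsum a haA, hao] at hNeq
  have hx := hsplit f fun l hl hlm => (hfl l hl hlm).trans hfi.symm
  rw [← sub_eq_iff_eq_add'.2 hfs, hfo, hfi] at hx
  have hsl : ∀ l, l ≠ o → l ≠ m → s l = s i := by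
    intro l hl hlm
    rw [hf l, hf i, hb l hl hlm, hfl l hl hlm, hfi]
  have hyi : ∀ l, l ≠ o → l ≠ m → y l = 2 * a i := by
    intro l hl hlm
    rw [hyl l hlm, hb l hl hlm]
  have hsi : s i = s o * a i - N := by rw [hf i, hfi, mul_one]
  have hspos := hpos s hs i
  have hsopos := hpos s hs o
  -- the minimal ratio of `s` to `a` is attained off `o`
  have hfm : f m * a i = a m := by
    refine le_antisymm (hfa m) ?_
    have hsa : s ≠ a := by
      rintro rfl
      have := hf1 m hmo
      omega
    have hsub : (Finset.univ.erase o).erase m ⊆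
        Finset.univ.filter fun i => ∀ j, s i * a j ≤ s j * a i := by
      intro l hl
      simp only [Finset.mem_erase] at hl
      simp only [Finset.mem_filter, Finset.mem_univ, true_and]
      intro j
      rw [hsl l hl.2.1 hl.1, hb l hl.2.1 hl.1, hsi, hf j]
      have := mul_le_mul_of_nonneg_left (hfa j) hNpos.le
      linarith
    by_contra hlt
    have hsub' : (Finset.univ.filter fun i => ∀ j, s i * a j ≤ s j * a i) ⊆
        (Finset.univ.erase o).erase m := by
      intro l hl
      simp only [Finset.mem_filter, Finset.mem_univ, true_and] at hl
      simp only [Finset.mem_erase, Finset.mem_univ, and_true]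
      constructor
      · rintro rfl
        apply hlt
        have h1 := hl i
        rw [hsi, hf l] at h1
        exact le_of_mul_le_mul_left (by linarith : N * a l ≤ N * (f l * a i)) hNpos
      · rintro rfl
        have h1 := hl i
        rw [hao, mul_one, hsi] at h1
        omega
    -- There would be exactly `d - 1` minimizers, neither `1` nor `d` because `d ≥ 3`.
    have hc := hcard a haA s hs hsa
    rw [Finset.Subset.antisymm hsub' hsub, hcompl] at hc
    omega
  have hsm : s m = f m * s i := by
    rw [hf m, hsi, ← hfm]; ring
  have hfm1 := hf1 m hmo
  have hsy : s ≠ y := by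
    rintro rfl
    omega
  -- Comparing `s` with `y`, the ratio is strictly larger at `o` and at `m` than elsewhere, so `d -
  -- 1` minimizers occur again.
  have hset : (Finset.univ.filter fun i => ∀ j, s i * y j ≤ s j * y i) =
      (Finset.univ.erase o).erase m := by
    ext l
    simp only [Finset.mem_filter, Finset.mem_univ, true_and, Finset.mem_erase, and_true]
    constructor
    · intro hl
      have h1 := hl i
      rw [hyi i hio him] at h1
      constructor
      · rintro rfl
        rw [hsm, hym, ← hfm] at h1
        have := mul_pos hspos hNpos
        nlinarith
      · rintro rfl
        rw [hyo] at h1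
        nlinarith [mul_pos hsopos (hapos i)]
    · rintro ⟨hlm, hlo⟩ j
      rw [hsl l hlo hlm, hyi l hlo hlm]
      rcases eq_or_ne j o with rfl | hjo
      · rw [hyo]
        nlinarith [mul_pos hsopos (hapos i)]
      rcases eq_or_ne j m with rfl | hjm
      · rw [hsm, hym, ← hfm]
        have := mul_pos hspos hNpos
        nlinarith
      · rw [hsl j hjo hjm, hyi j hjo hjm]
  have hc := hcard y hy s hs hsy
  rw [hset, hcompl] at hc
  omega

end Weights

/-! ### Existence of the extremal lattice point. -/

section Extremal

variable {ι : Type*} [Fintype ι] [DecidableEq ι]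

theorem IsTight.ratioArgmin_card {M : Matrix ι ι ℤ} {P : Finset (ι → ℤ)} (ht : IsTight M P)
    {h : (ι → ℤ) →ₗ[ℤ] ℤ} (hP : ∀ z ∈ P, h z = 1) (hr : ∀ i, h (M i) = 1)
    (hpos : ∀ z ∈ P, ∀ i, 0 < scaledBary M z i) {d : ℕ} (hd : 0 < d)
    (hι : Fintype.card ι = d + 1) {q z : ι → ℤ} (hq : q ∈ P) (hz : z ∈ P) (hne : z ≠ q) :
    (ratioArgmin M q z).card = 1 ∨ (ratioArgmin M q z).card = d := by
  have hdim : ∀ z ∈ P, faceDim M z = d := fun z hz => by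
    rw [faceDim_of_forall_pos (hpos z hz), hι, Nat.add_sub_cancel]
  have h1 := (ht.updateRow_and hP hr hq (by rw [hdim q hq]; exact hd)).2 z hz hne
  rw [hdim z hz, sum_faceDim_updateRow ht.det_pos (fun i => (hpos q hq i).le) (hpos z hz), hι] at h1
  have hle : (ratioArgmin M q z).card ≤ d + 1 := hι ▸ Finset.card_le_univ _
  obtain ⟨e, he⟩ := Nat.exists_eq_add_of_le hle
  rw [he, Nat.add_sub_cancel_left] at h1
  set m := (ratioArgmin M q z).card
  have h2 : ((m : ℤ) - 1) * (m - d) = 0 := by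
    have h3 : (d : ℤ) = m * e := by exact_mod_cast h1
    have h4 : (d : ℤ) + 1 = m + e := by exact_mod_cast he
    have h5 : (e : ℤ) = d + 1 - m := by omega
    rw [h5] at h3
    linarith
  rcases mul_eq_zero.1 h2 with h3 | h3
  · left; omega
  · right; omega

/-- A tight simplex all of whose marked points are interior contains a lattice point whose
barycentric coordinates, with one exception, are as small as possible. -/
theorem IsTight.exists_extremal {M : Matrix ι ι ℤ} {P : Finset (ι → ℤ)} (ht : IsTight M P)
    {h : (ι → ℤ) →ₗ[ℤ] ℤ} (hP : ∀ z ∈ P, h z = 1) (hr : ∀ i, h (M i) = 1)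
    (hpos : ∀ z ∈ P, ∀ i, 0 < scaledBary M z i) (hne : P.Nonempty) {d k : ℕ} (hd : 3 ≤ d)
    (hι : Fintype.card ι = d + 1) (hdet : M.det = d * k + 1) :
    ∃ j, ∃ γ : ι → ℤ, h γ = 1 ∧
      M.det • γ = (M.det - d) • M j + ∑ l ∈ Finset.univ.erase j, M l := by
  have hM := ht.det_pos
  have hdim : ∀ z ∈ P, 0 < faceDim M z := fun z hz => by
    rw [faceDim_of_forall_pos (hpos z hz), hι]; omega
  have : Nonempty ι := Fintype.card_pos_iff.1 (by omega)
  obtain ⟨o⟩ := this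
  obtain ⟨p₀, hp₀⟩ := hne
  obtain ⟨p, hp, hpd, hpo⟩ := ht.exists_scaledBary_eq_one hP hr o ⟨p₀, hp₀, hdim p₀ hp₀⟩
    fun z hz _ => hpos z hz o
  have hsum : ∀ z ∈ P, ∑ i, scaledBary M z i = M.det := fun z hz =>
    sum_scaledBary M h hr (hP z hz)
  have hdvd : ∀ z ∈ P, ∀ l,
      M.det ∣ scaledBary M z o * scaledBary M p l - scaledBary M z l := by
    intro z _ l
    rcases eq_or_ne l o with rfl | hl
    · simp [hpo]
    · have := det_mul_scaledBary_updateRow M p z hl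
      rw [hpo, one_mul] at this
      exact ⟨-scaledBary (M.updateRow o p) z l, by linarith⟩
  have hw : (∀ i, i ≠ o → scaledBary M p i = k) ∨ ∃ j, ∀ i, i ≠ j → scaledBary M p i = 1 := by
    classical
    refine weights_eq_of_ratioArgmin_card (d := d) (N := M.det) (A := P.image (scaledBary M))
      (by omega) (by exact_mod_cast hι) hdet ?_ ?_ ?_ (Finset.mem_image_of_mem _ hp) hpo ?_ ?_
    · intro z hz
      obtain ⟨z, hzP, rfl⟩ := Finset.mem_image.1 hz
      exact hpos z hzP
    · intro z hz
      obtain ⟨z, hzP, rfl⟩ := Finset.mem_image.1 hz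
      exact hsum z hzP
    · intro q hq z hz hzq
      obtain ⟨q, hqP, rfl⟩ := Finset.mem_image.1 hq
      obtain ⟨z, hzP, rfl⟩ := Finset.mem_image.1 hz
      have hne : z ≠ q := by rintro rfl; exact hzq rfl
      have heq : (Finset.univ.filter fun i => ∀ j, scaledBary M z i * scaledBary M q j ≤
          scaledBary M z j * scaledBary M q i) = ratioArgmin M q z := by
        ext i
        simp [mem_ratioArgmin, hpos q hqP i]
      rw [heq]
      exact_mod_cast ht.ratioArgmin_card hP hr hpos (by omega) hι hqP hzP hne
    · intro z hz
      obtain ⟨z, hzP, rfl⟩ := Finset.mem_image.1 hz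
      exact hdvd z hzP
    · intro i hio hi
      have hti := (ht.updateRow_and hP hr hp hpd).1 i (hpos p hp i)
      have hri := apply_updateRow_eq_one hr (hP p hp) i
      have hdo : ∀ z, M.det * scaledBary (M.updateRow i p) z o
          = scaledBary M p i * scaledBary M z o - scaledBary M z i := by
        intro z
        rw [det_mul_scaledBary_updateRow M p z hio.symm, hpo, mul_one]
      -- A tight piece of determinant greater than one must contain a marked point that is not a
      -- vertex.
      have hex : ∃ z ∈ P, 0 < faceDim (M.updateRow i p) z := by
        by_contra! H
        have : scaledBary M p i = _ := hti
        rw [Finset.sum_eq_zero fun z hz => Nat.le_zero.1 (H z hz)] at this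
        simp at this
        omega
      obtain ⟨s, hs, hsd, hso⟩ := hti.exists_scaledBary_eq_one hP hri o hex (by
        intro z hz hzd
        have hz0 := nonneg_of_faceDim_pos hzd
        refine lt_of_le_of_ne (hz0 o) fun h0 => ?_
        have hmin := ((faceDim_updateRow_le hM (hpos p hp i)).1 hz0).2
        have h1 := hdo z
        rw [← h0, mul_zero] at h1
        have h2 : ∀ l ∈ Finset.univ,
            scaledBary M z o * scaledBary M p l ≤ scaledBary M z l := by
          intro l _
          have h3 := hmin l
          refine le_of_mul_le_mul_right ?_ (hpos p hp i)
          calc scaledBary M z o * scaledBary M p l * scaledBary M p i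
              = scaledBary M z i * scaledBary M p l := by
                rw [show scaledBary M z i = scaledBary M p i * scaledBary M z o by linarith]
                ring
            _ ≤ _ := h3
        -- Both sides sum to multiples of the determinant, which forces `scaledBary M z o = 1` and
        -- then `z = p`, a vertex of the piece.
        have h4 := Finset.sum_le_sum h2
        rw [← Finset.mul_sum, hsum p hp, hsum z hz] at h4
        have h5 : scaledBary M z o = 1 := by
          have := hpos z hz o
          nlinarith
        have h6 : ∑ l, scaledBary M z o * scaledBary M p l = ∑ l, scaledBary M z l := by
          rw [← Finset.mul_sum, hsum p hp, hsum z hz, h5, one_mul]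
        have h7 := (Finset.sum_eq_sum_iff_of_le h2).1 h6
        have : z = p := eq_of_scaledBary_eq hM.ne' fun l => by
          rw [← h7 l (Finset.mem_univ l), h5, one_mul]
        rw [this, faceDim_updateRow_self] at hzd
        exact lt_irrefl _ hzd)
      refine ⟨scaledBary M s, Finset.mem_image_of_mem _ hs, ?_, ?_⟩
      · rw [← hdo s, hso, mul_one]
      · exact ((faceDim_updateRow_le hM (hpos p hp i)).1 (nonneg_of_faceDim_pos hsd)).2
  have hs := hsum p hp
  suffices H : ∀ V : ι → ι → ℤ, (∀ i, h (V i) = 1) →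
      ∑ i, scaledBary M p i • V i = M.det • p → ∃ j, ∃ γ : ι → ℤ, h γ = 1 ∧
      M.det • γ = (M.det - d) • V j + ∑ l ∈ Finset.univ.erase j, V l from
    H (fun l => M l) hr (sum_scaledBary_smul M p)
  intro V hV hcomb
  rcases hw with hw | ⟨j, hj⟩
  -- Scaling `(1, k, …, k)` by `N - d` and subtracting `N(k - 1)` off `o` leaves `(N - d)k - N(k -
  -- 1) = N - dk = 1` there.
  · refine ⟨o, (M.det - d) • p - ((k : ℤ) - 1) • ∑ l ∈ Finset.univ.erase o, V l, ?_, ?_⟩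
    · rw [map_sub, map_smul, map_smul, map_sum, Finset.sum_congr rfl fun l _ => hV l, hP p hp,
        Finset.sum_const, Finset.card_erase_of_mem (Finset.mem_univ o), Finset.card_univ, hι, hdet]
      simp
      ring
    · rw [← Finset.add_sum_erase _ _ (Finset.mem_univ o), hpo, one_smul,
        Finset.sum_congr rfl fun l hl => by rw [hw l (Finset.ne_of_mem_erase hl)],
        ← Finset.smul_sum] at hcomb
      rw [smul_sub, smul_comm, ← hcomb, hdet]
      module
  · refine ⟨j, p, hP p hp, ?_⟩
    rw [← hcomb, ← Finset.add_sum_erase _ _ (Finset.mem_univ j)]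
    rw [← Finset.add_sum_erase _ _ (Finset.mem_univ j),
      Finset.sum_congr rfl fun l hl => hj l (Finset.ne_of_mem_erase hl), Finset.sum_const,
      Finset.card_erase_of_mem (Finset.mem_univ j), Finset.card_univ, hι] at hs
    congr 1
    · congr 1
      simp at hs
      linarith
    · exact Finset.sum_congr rfl fun l hl => by rw [hj l (Finset.ne_of_mem_erase hl), one_smul]

end Extremal

/-! ### Volume of a simplex. -/

section Volume

/-- The corner simplex `{x ≥ 0, ∑ x ≤ r}`. -/
def cornerSimplex (d : ℕ) (r : ℝ) : Set (Fin d → ℝ) := {x | (∀ i, 0 ≤ x i) ∧ ∑ i, x i ≤ r}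

theorem isClosed_cornerSimplex (d : ℕ) (r : ℝ) : IsClosed (cornerSimplex d r) := by
  have : cornerSimplex d r = (⋂ i, {x | 0 ≤ x i}) ∩ {x | ∑ i, x i ≤ r} := by
    ext; simp [cornerSimplex]
  rw [this]
  exact (isClosed_iInter fun i => isClosed_le (by fun_prop) (by fun_prop)).inter
    (isClosed_le (by fun_prop) (by fun_prop))

/-- Fubini in the first coordinate: the slice at `t` is the corner simplex of size `r - t`, hence
the induction over all `r`. -/
theorem volume_cornerSimplex (d : ℕ) {r : ℝ} (hr : 0 ≤ r) :
    volume (cornerSimplex d r) = ENNReal.ofReal (r ^ d / (d ! : ℝ)) := by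
  induction d generalizing r with
  | zero =>
    have : cornerSimplex 0 r = Set.univ := by
      ext x; simp [cornerSimplex, hr]
    rw [this, volume_pi, Measure.pi_of_empty]
    simp
  | succ d ih =>
    let e := MeasurableEquiv.piFinSuccAbove (fun _ : Fin (d + 1) => ℝ) 0
    have he := volume_preserving_piFinSuccAbove (fun _ : Fin (d + 1) => ℝ) 0
    let S : Set (ℝ × (Fin d → ℝ)) := {p | 0 ≤ p.1 ∧ p.2 ∈ cornerSimplex d (r - p.1)}
    have hS : cornerSimplex (d + 1) r = e ⁻¹' S := by
      ext x
      simp only [cornerSimplex, Set.mem_ofPred_eq, Set.mem_preimage, S, e,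
        MeasurableEquiv.piFinSuccAbove_apply, Fin.forall_fin_succ, Fin.sum_univ_succ, and_assoc]
      simp only [Fin.insertNthEquiv_zero, Fin.consEquiv_symm_apply, Fin.tail]
      rw [le_sub_iff_add_le']
    have hSm : MeasurableSet S := by
      have : S = e.symm ⁻¹' cornerSimplex (d + 1) r := by
        rw [hS, ← Set.preimage_comp]; simp
      rw [this]
      exact e.symm.measurable (isClosed_cornerSimplex _ _).measurableSet
    rw [hS, he.measure_preimage hSm.nullMeasurableSet, Measure.volume_eq_prod,
      Measure.prod_apply hSm]
    have hsec : ∀ t : ℝ, volume (Prod.mk t ⁻¹' S) =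
        (Set.Icc 0 r).indicator (fun t => ENNReal.ofReal ((r - t) ^ d / (d ! : ℝ))) t := by
      intro t
      by_cases ht : t ∈ Set.Icc 0 r
      · rw [Set.indicator_of_mem ht, ← ih (sub_nonneg.2 ht.2)]
        congr 1
        ext x
        simp [S, ht.1]
      · rw [Set.indicator_of_notMem ht]
        have : Prod.mk t ⁻¹' S = ∅ := by
          ext x
          simp only [Set.mem_preimage, S, Set.mem_ofPred_eq, cornerSimplex, Set.mem_empty_iff_false,
            iff_false]
          rintro ⟨h1, h2, h3⟩
          exact ht ⟨h1, by linarith [Finset.sum_nonneg fun i (_ : i ∈ Finset.univ) => h2 i]⟩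
        rw [this, measure_empty]
    simp_rw [hsec]
    rw [lintegral_indicator measurableSet_Icc, ← ofReal_integral_eq_lintegral_ofReal]
    · congr 1
      rw [integral_Icc_eq_integral_Ioc, ← intervalIntegral.integral_of_le hr,
        intervalIntegral.integral_comp_sub_left (fun t => t ^ d / (d ! : ℝ)),
        intervalIntegral.integral_div, integral_pow, Nat.factorial_succ]
      simp
      field_simp
    · exact (Continuous.continuousOn (by fun_prop)).integrableOn_Icc
    · refine (ae_restrict_iff' measurableSet_Icc).2 (Filter.Eventually.of_forall fun t ht => ?_)
      have := sub_nonneg.2 ht.2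
      simp only [Pi.zero_apply]
      positivity

theorem convexHull_range_cons_zero_single (d : ℕ) :
    convexHull ℝ (Set.range (Fin.cons 0 fun i => Pi.single i 1 : Fin (d + 1) → Fin d → ℝ)) =
      cornerSimplex d 1 := by
  apply Set.Subset.antisymm
  · refine convexHull_min ?_ ?_
    · rintro _ ⟨i, rfl⟩
      induction i using Fin.cases with
      | zero => simp [cornerSimplex]
      | succ i =>
        refine ⟨fun j => ?_, by simp⟩
        simp only [Fin.cons_succ, Pi.single_apply]
        split_ifs <;> norm_num
    · rintro x ⟨hx, hx'⟩ y ⟨hy, hy'⟩ a b ha hb hab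
      refine ⟨fun i => ?_, ?_⟩
      · have := hx i
        have := hy i
        simp only [Pi.add_apply, Pi.smul_apply, smul_eq_mul]
        positivity
      · simp only [Pi.add_apply, Pi.smul_apply, smul_eq_mul, Finset.sum_add_distrib,
          ← Finset.mul_sum]
        nlinarith
  · rintro x ⟨hx, hx'⟩
    have h := (convex_convexHull ℝ (Set.range
      (Fin.cons 0 fun i => Pi.single i 1 : Fin (d + 1) → Fin d → ℝ))).sum_mem
      (t := Finset.univ) (w := (Fin.cons (1 - ∑ i, x i) x : Fin (d + 1) → ℝ))
      (z := (Fin.cons 0 fun i => Pi.single i 1 : Fin (d + 1) → Fin d → ℝ)) ?_ ?_ ?_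
    · convert h
      rw [Fin.sum_univ_succ]
      ext j
      simp [Finset.sum_apply, Pi.single_apply]
    · intro i _
      induction i using Fin.cases with
      | zero => simpa using hx'
      | succ i => exact hx i
    · rw [Fin.sum_univ_succ]; simp
    · exact fun i _ => subset_convexHull _ _ ⟨i, rfl⟩

/-- The volume of a simplex is the determinant of its edge vectors divided by `d!`. -/
theorem volume_convexHull_range {d : ℕ} (v : Fin (d + 1) → Fin d → ℝ) :
    volume (convexHull ℝ (Set.range v)) =
      ENNReal.ofReal (|(Matrix.of fun i : Fin d => v i.succ - v 0).det| / (d ! : ℝ)) := by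
  set U : Matrix (Fin d) (Fin d) ℝ := Matrix.of fun i : Fin d => v i.succ - v 0
  have hcomp : v = (fun x => x + v 0) ∘ (Matrix.toLin' Uᵀ) ∘
      (Fin.cons 0 fun i => Pi.single i 1 : Fin (d + 1) → Fin d → ℝ) := by
    funext i
    induction i using Fin.cases with
    | zero => simp
    | succ i =>
      ext j
      simp [U]
  have him : convexHull ℝ (Set.range v) =
      (fun x => x + v 0) '' (Matrix.toLin' Uᵀ '' cornerSimplex d 1) := by
    rw [← convexHull_range_cons_zero_single]
    conv_lhs => rw [hcomp]
    rw [Set.range_comp, Set.range_comp, LinearMap.image_convexHull]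
    exact (AffineMap.image_convexHull ((AffineEquiv.vaddConst ℝ (v 0)).toAffineMap) _).symm
  rw [him, Set.image_add_right, measure_preimage_add_right,
    Measure.addHaar_image_linearMap, LinearMap.det_toLin', Matrix.det_transpose,
    volume_cornerSimplex d zero_le_one, ← ENNReal.ofReal_mul (abs_nonneg _)]
  congr 1
  simp [div_eq_mul_inv]

end Volume

/-! ### Lattice simplices as integer matrices, and the unimodular map. -/

section Lattice

/-- The real point with the same coordinates as an integer vector. -/
def intPoint {d : ℕ} (z : Fin d → ℤ) : Fin d → ℝ := fun i => (z i : ℝ)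

theorem intPoint_injective {d : ℕ} : Function.Injective (intPoint (d := d)) := fun _ _ h =>
  funext fun i => Int.cast_injective (congrFun h i)

/-- The matrix whose rows are the points `v i` in homogeneous coordinates. -/
def homogeneousMatrix {d : ℕ} (v : Fin (d + 1) → Fin d → ℤ) :
    Matrix (Fin (d + 1)) (Fin (d + 1)) ℤ :=
  Matrix.of fun i => (Fin.cons 1 (v i) : Fin (d + 1) → ℤ)

/-- The matrix whose rows are the edge vectors at `v 0`. -/
def edgeMatrix {d : ℕ} (v : Fin (d + 1) → Fin d → ℤ) : Matrix (Fin d) (Fin d) ℤ :=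
  Matrix.of fun i => v i.succ - v 0

theorem det_homogeneousMatrix {d : ℕ} (v : Fin (d + 1) → Fin d → ℤ) :
    (homogeneousMatrix v).det = (edgeMatrix v).det := by
  rw [Matrix.det_eq_of_forall_row_eq_smul_add_const
    (B := Matrix.of (Fin.cons (Fin.cons 1 (v 0)) fun i => Fin.cons 0 (v i.succ - v 0) :
      Fin (d + 1) → Fin (d + 1) → ℤ)) (Fin.cons 0 fun _ => 1) 0 (by simp)]
  · rw [Matrix.det_succ_column_zero, Fin.sum_univ_succ]
    simp only [Matrix.of_apply, Fin.cons_zero, Fin.cons_succ, mul_zero, zero_mul,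
      Finset.sum_const_zero, add_zero, Fin.val_zero, pow_zero, one_mul, mul_one]
    congr 1
  · intro i j
    induction i using Fin.cases with
    | zero => simp [homogeneousMatrix]
    | succ i =>
      induction j using Fin.cases with
      | zero => simp [homogeneousMatrix]
      | succ j => simp [homogeneousMatrix]

theorem det_homogeneousMatrix_comp {d : ℕ} (v : Fin (d + 1) → Fin d → ℤ)
    (σ : Equiv.Perm (Fin (d + 1))) :
    (homogeneousMatrix (v ∘ σ)).det = Equiv.Perm.sign σ * (homogeneousMatrix v).det := by
  exact Matrix.det_permute σ (homogeneousMatrix v)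

theorem volume_convexHull_intPoint {d : ℕ} (v : Fin (d + 1) → Fin d → ℤ) :
    volume (convexHull ℝ (Set.range (intPoint ∘ v))) =
      ENNReal.ofReal (|((homogeneousMatrix v).det : ℝ)| / (d ! : ℝ)) := by
  rw [volume_convexHull_range, det_homogeneousMatrix]
  congr 3
  rw [Int.cast_det]
  congr 1
  ext i j
  simp [edgeMatrix, intPoint]

theorem range_comp_equiv {d : ℕ} (v : Fin (d + 1) → Fin d → ℤ) (σ : Equiv.Perm (Fin (d + 1))) :
    Set.range (intPoint ∘ (v ∘ σ)) = Set.range (intPoint ∘ v) :=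
  EquivLike.range_comp (intPoint ∘ v) σ

/-- The scaled barycentric coordinates are the barycentric coordinates times the determinant. -/
theorem det_mul_coord {d : ℕ} {v : Fin (d + 1) → Fin d → ℤ} (b : AffineBasis (Fin (d + 1)) ℝ
    (Fin d → ℝ)) (hb : ⇑b = intPoint ∘ v) (hN : (homogeneousMatrix v).det ≠ 0) (z : Fin d → ℤ)
    (i : Fin (d + 1)) :
    ((homogeneousMatrix v).det : ℝ) * b.coord i (intPoint z) =
      scaledBary (homogeneousMatrix v) (Fin.cons 1 z) i := by
  have hN' : ((homogeneousMatrix v).det : ℝ) ≠ 0 := by exact_mod_cast hN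
  have h := sum_scaledBary_smul (homogeneousMatrix v) (Fin.cons 1 z)
  set D := scaledBary (homogeneousMatrix v) (Fin.cons 1 z)
  set N := (homogeneousMatrix v).det
  have h0 : ∑ i, D i = N := by simpa [homogeneousMatrix] using congrFun h 0
  have hs : ∀ j, ∑ i, D i * v i j = N * z j := by
    intro j
    simpa [homogeneousMatrix] using congrFun h j.succ
  have hw : ∑ i, (D i : ℝ) / N = 1 := by
    rw [← Finset.sum_div, div_eq_one_iff_eq hN']
    exact_mod_cast h0
  have hz : intPoint z = Finset.univ.affineCombination ℝ b fun i => (D i : ℝ) / N := by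
    rw [Finset.affineCombination_eq_linear_combination _ _ _ hw, hb]
    ext j
    have := hs j
    simp only [Finset.sum_apply, Pi.smul_apply, Function.comp_apply, intPoint, smul_eq_mul]
    simp_rw [div_mul_eq_mul_div]
    rw [← Finset.sum_div, eq_div_iff hN', mul_comm]
    exact_mod_cast this.symm
  rw [hz, b.coord_apply_combination_of_mem (Finset.mem_univ i) hw]
  field_simp

theorem exists_vertices {d k : ℕ} (hd : 1 ≤ d) {T : Set (Fin d → ℝ)} (hT : IsLatticeSimplex d T)
    (hvol : volume T = ENNReal.ofReal (((d : ℝ) * (k : ℝ) + 1) / (d ! : ℝ))) :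
    ∃ v : Fin (d + 1) → Fin d → ℤ, (homogeneousMatrix v).det = d * k + 1 ∧
      AffineIndependent ℝ (intPoint ∘ v) ∧ T = convexHull ℝ (Set.range (intPoint ∘ v)) := by
  obtain ⟨s, hs, rfl⟩ := hT
  choose v hv using hs
  have hv : intPoint ∘ v = s.points := funext hv
  have hind := s.independent
  rw [← hv] at hvol hind ⊢
  rw [volume_convexHull_intPoint, ENNReal.ofReal_eq_ofReal_iff (by positivity) (by positivity),
    div_left_inj' (by positivity)] at hvol
  have hdet : |(homogeneousMatrix v).det| = d * k + 1 := by exact_mod_cast hvol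
  rcases abs_choice (homogeneousMatrix v).det with h | h
  · exact ⟨v, h ▸ hdet, hind, rfl⟩
  · have hne : (0 : Fin (d + 1)) ≠ Fin.last d := by
      rw [Ne, Fin.ext_iff]; simp; omega
    -- Exchanging two vertices makes a negative determinant positive.
    refine ⟨v ∘ Equiv.swap 0 (Fin.last d), ?_, ?_, ?_⟩
    · rw [det_homogeneousMatrix_comp, Equiv.Perm.sign_swap hne, ← hdet, h]
      simp
    · exact hind.comp_embedding (Equiv.swap 0 (Fin.last d)).toEmbedding
    · rw [range_comp_equiv]

theorem exists_interior_finset {d k : ℕ} {v : Fin (d + 1) → Fin d → ℤ}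
    (hdet : 0 < (homogeneousMatrix v).det) (hind : AffineIndependent ℝ (intPoint ∘ v))
    (hk : (interior (convexHull ℝ (Set.range (intPoint ∘ v))) ∩ latticePoints d).encard = k) :
    ∃ P : Finset (Fin (d + 1) → ℤ), P.card = k ∧
      ∀ z ∈ P, z 0 = 1 ∧ ∀ i, 0 < scaledBary (homogeneousMatrix v) z i := by
  classical
  let b : AffineBasis (Fin (d + 1)) ℝ (Fin d → ℝ) := ⟨intPoint ∘ v, hind, by
    rw [hind.affineSpan_eq_top_iff_card_eq_finrank_add_one]; simp⟩
  have hb : ⇑b = intPoint ∘ v := rfl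
  set Z : Set (Fin d → ℤ) := {z | intPoint z ∈ interior (convexHull ℝ (Set.range b))}
  have hZ : intPoint '' Z = interior (convexHull ℝ (Set.range b)) ∩ latticePoints d := by
    ext x
    constructor
    · rintro ⟨z, hz, rfl⟩
      exact ⟨hz, z, rfl⟩
    · rintro ⟨hx, z, rfl⟩
      exact ⟨z, hx, rfl⟩
  have hcard : Z.encard = k := by
    rw [← hk, ← hb, ← hZ, intPoint_injective.encard_image]
  have hfin : Z.Finite := Set.finite_of_encard_eq_coe hcard
  refine ⟨hfin.toFinset.image fun z => (Fin.cons 1 z : Fin (d + 1) → ℤ), ?_, ?_⟩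
  · rw [Finset.card_image_of_injective _ (Fin.cons_right_injective _)]
    have := hfin.encard_eq_coe_toFinset_card
    rw [hcard] at this
    exact_mod_cast this.symm
  · intro z hz
    obtain ⟨z, hzZ, rfl⟩ := Finset.mem_image.1 hz
    have hz : intPoint z ∈ interior (convexHull ℝ (Set.range b)) := hfin.mem_toFinset.1 hzZ
    rw [b.interior_convexHull] at hz
    refine ⟨rfl, fun i => ?_⟩
    have h1 := det_mul_coord b hb hdet.ne' z i
    have h2 : (0 : ℝ) < (homogeneousMatrix v).det := by exact_mod_cast hdet
    have h3 := mul_pos h2 (hz i)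
    rw [h1] at h3
    exact_mod_cast h3

/-- The rows of the matrix are the vertices other than the origin of the extremal simplex. -/
def extremalMatrix (k n : ℕ) : Matrix (Fin (n + 1)) (Fin (n + 1)) ℤ :=
  Matrix.of (Fin.snoc (fun i : Fin n => Pi.single i.castSucc 1) (extremalPoint k (n + 1)) :
    Fin (n + 1) → Fin (n + 1) → ℤ)

theorem extremalMatrix_castSucc (k n : ℕ) (i : Fin n) :
    extremalMatrix k n i.castSucc = Pi.single i.castSucc 1 := by
  funext j
  simp [extremalMatrix]

theorem extremalMatrix_last (k n : ℕ) :
    extremalMatrix k n (Fin.last n) = extremalPoint k (n + 1) := by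
  funext j
  simp [extremalMatrix]

theorem det_extremalMatrix (k n : ℕ) :
    (extremalMatrix k n).det = ((n + 1 : ℕ) : ℤ) * k + 1 := by
  rw [Matrix.det_of_isLowerTriangular, Fin.prod_univ_castSucc]
  · simp [extremalMatrix_castSucc, extremalMatrix_last, extremalPoint]
  · intro i j hij
    induction i using Fin.lastCases with
    | last => exact absurd hij (not_lt.2 (Fin.le_last j))
    | cast i =>
      rw [extremalMatrix_castSucc]
      have hij : i.castSucc < j := hij
      exact Pi.single_eq_of_ne (M := fun _ => ℤ) hij.ne' 1

theorem pointSimplex_extremalPoint (k n : ℕ) :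
    pointSimplex (extremalPoint k (n + 1)) =
      convexHull ℝ ({0} ∪ Set.range fun i => intPoint (extremalMatrix k n i)) := by
  rw [pointSimplex, Set.union_assoc]
  congr 2
  ext x
  have hsingle : ∀ i : Fin n, intPoint (extremalMatrix k n i.castSucc) =
      Pi.single i.castSucc 1 := by
    intro i
    rw [extremalMatrix_castSucc]
    ext j
    simp only [intPoint, Pi.single_apply]
    split_ifs <;> simp
  simp only [Set.mem_union, Set.mem_ofPred_eq, Set.mem_singleton_iff, Set.mem_range,
    Fin.exists_fin_succ', hsingle, extremalMatrix_last, Fin.val_castSucc, Fin.val_last,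
    lt_self_iff_false, false_and, or_false, add_lt_add_iff_right, Fin.is_lt, true_and,
    @eq_comm _ x]
  rfl

theorem image_integerAffineMap_convexHull {d : ℕ} (M : Matrix (Fin d) (Fin d) ℤ) (u : Fin d → ℤ)
    (s : Set (Fin d → ℝ)) :
    integerAffineMap M u '' convexHull ℝ s = convexHull ℝ (integerAffineMap M u '' s) := by
  have : integerAffineMap M u = (AffineEquiv.vaddConst ℝ (intPoint u)).toAffineMap ∘
      Matrix.vecMulLinear (M.map fun z : ℤ => (z : ℝ)) := rfl
  rw [this, Set.image_comp, Set.image_comp, LinearMap.image_convexHull,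
    AffineMap.image_convexHull]

theorem integerAffineMap_intPoint {d : ℕ} (M : Matrix (Fin d) (Fin d) ℤ) (u z : Fin d → ℤ) :
    integerAffineMap M u (intPoint z) = intPoint (z ᵥ* M + u) := by
  ext j
  simp [integerAffineMap, intPoint, Matrix.vecMul, dotProduct]

/-- A lattice simplex of the extremal volume with a lattice point as close as possible to all
facets but one is unimodularly equivalent to the extremal simplex. -/
theorem unimodularlyEquivalent_extremal {n k : ℕ} (u : Fin (n + 2) → Fin (n + 1) → ℤ)
    (hdet : |(edgeMatrix u).det| = ((n + 1 : ℕ) : ℤ) * k + 1) (γ : Fin (n + 1) → ℤ)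
    (hγ : (((n + 1 : ℕ) : ℤ) * k + 1) • (γ - u 0) = ∑ i : Fin (n + 1), (u i.succ - u 0)) :
    UnimodularlyEquivalent (convexHull ℝ (Set.range (intPoint ∘ u)))
      (pointSimplex (extremalPoint k (n + 1))) := by
  let E : Fin (n + 1) → Fin (n + 1) → ℤ := fun i => u i.succ - u 0
  -- The last row is chosen so that `(dk, …, dk, dk + 1)` goes to `(dk + 1)(γ - u 0)` minus the
  -- first `n` edges, which is the last edge by `hγ`.
  let M : Matrix (Fin (n + 1)) (Fin (n + 1)) ℤ := Matrix.of (Fin.snoc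
    (fun i : Fin n => E i.castSucc) ((γ - u 0) - ∑ i : Fin n, E i.castSucc) :
    Fin (n + 1) → Fin (n + 1) → ℤ)
  have hrow : ∀ i, extremalMatrix k n i ᵥ* M = E i := by
    intro i
    induction i using Fin.lastCases with
    | cast i =>
      rw [extremalMatrix_castSucc, Matrix.single_one_vecMul]
      funext j
      simp [M]
    | last =>
      rw [extremalMatrix_last]
      have h1 : E (Fin.last n) = (((n + 1 : ℕ) : ℤ) * k + 1) • (γ - u 0)
          - ∑ i : Fin n, E i.castSucc := by
        rw [hγ, Fin.sum_univ_castSucc]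
        simp [E]
      rw [h1]
      funext j
      simp only [Matrix.vecMul, dotProduct, Fin.sum_univ_castSucc, M, Matrix.of_apply,
        Fin.snoc_castSucc, Fin.snoc_last, extremalPoint, Fin.val_castSucc, Fin.val_last, if_true,
        Pi.sub_apply, Pi.smul_apply, Finset.sum_apply, smul_eq_mul]
      rw [Finset.sum_congr rfl fun i _ => by rw [if_neg (by omega)], ← Finset.mul_sum]
      ring
  have hmul : extremalMatrix k n * M = edgeMatrix u := by
    funext i
    exact (Matrix.mul_apply_eq_vecMul _ _ i).trans (hrow i)
  have hN : (0 : ℤ) < ((n + 1 : ℕ) : ℤ) * k + 1 := by positivity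
  refine ⟨M, u 0, ?_, ?_⟩
  · have h1 := congrArg Matrix.det hmul
    rw [Matrix.det_mul, det_extremalMatrix] at h1
    rw [← h1, abs_mul, abs_of_pos hN] at hdet
    have : |M.det| = 1 := mul_left_cancel₀ hN.ne' (by rw [hdet, mul_one])
    exact (abs_eq zero_le_one).1 this
  · rw [pointSimplex_extremalPoint, image_integerAffineMap_convexHull, Set.image_union,
      Set.image_singleton, ← Set.range_comp]
    congr 1
    ext x
    simp only [Set.mem_range, Set.mem_union, Set.mem_singleton_iff, Function.comp_apply,
      integerAffineMap_intPoint, hrow, E, sub_add_cancel]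
    rw [Fin.exists_fin_succ]
    refine or_congr ?_ Iff.rfl
    rw [eq_comm]
    have : integerAffineMap M (u 0) 0 = intPoint (u 0) := by
      rw [integerAffineMap, Matrix.zero_vecMul, zero_add]; rfl
    rw [this]

end Lattice

theorem mainTheorem2 (d k : ℕ) (hd : 3 ≤ d) (hk : 1 ≤ k) (T : Set (Fin d → ℝ))
    (hT : T ∈ cleanLatticeSimplices k d)
    (hvol : volume T = ENNReal.ofReal (((d : ℝ) * (k : ℝ) + 1) / (d ! : ℝ))) :
    UnimodularlyEquivalent T (pointSimplex (extremalPoint k d)) := by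
  obtain ⟨hsimplex, -, hcount⟩ := hT
  obtain ⟨v, hdet, hind, rfl⟩ := exists_vertices (by omega) hsimplex hvol
  have hpos : 0 < (homogeneousMatrix v).det := by rw [hdet]; positivity
  obtain ⟨P, hPcard, hP⟩ := exists_interior_finset hpos hind hcount
  have hr : ∀ i, (LinearMap.proj 0 : (Fin (d + 1) → ℤ) →ₗ[ℤ] ℤ)
      (homogeneousMatrix v i) = 1 := fun i => rfl
  have ht : IsTight (homogeneousMatrix v) P := by
    rw [IsTight, Finset.sum_congr rfl fun z hz => faceDim_of_forall_pos (hP z hz).2, hdet]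
    simp [hPcard]
    ring
  obtain ⟨j, γ, -, hγ⟩ := ht.exists_extremal (fun z hz => (hP z hz).1) hr
    (fun z hz => (hP z hz).2) (Finset.card_pos.1 (by omega)) hd (by simp) hdet
  obtain ⟨n, rfl⟩ : ∃ n, d = n + 1 := ⟨d - 1, by omega⟩
  -- The exceptional vertex `j` moves to index `0` and becomes the image of the origin.
  rw [← range_comp_equiv v (Equiv.swap 0 j)]
  refine unimodularlyEquivalent_extremal (v ∘ Equiv.swap 0 j) ?_ (Fin.tail γ) ?_
  · rw [← det_homogeneousMatrix, det_homogeneousMatrix_comp, abs_mul, hdet]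
    rw [abs_of_pos (a := ((n + 1 : ℕ) : ℤ) * k + 1) (by positivity)]
    rcases Int.units_eq_one_or (Equiv.Perm.sign (Equiv.swap 0 j)) with h | h <;> simp [h]
  · have h1 : ∑ i : Fin (n + 1), (v ∘ Equiv.swap 0 j) i.succ
        = ∑ l ∈ Finset.univ.erase j, v l := by
      have h2 := Equiv.sum_comp (Equiv.swap 0 j) v
      rw [Fin.sum_univ_succ, ← Finset.add_sum_erase _ _ (Finset.mem_univ j),
        Equiv.swap_apply_left] at h2
      exact add_left_cancel h2
    rw [Finset.sum_sub_distrib, h1]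
    rw [hdet] at hγ
    funext i
    have h3 : (((n + 1 : ℕ) : ℤ) * k + 1) * γ i.succ =
        (((n + 1 : ℕ) : ℤ) * k + 1 - (n + 1 : ℕ)) * v j i + ∑ l ∈ Finset.univ.erase j, v l i := by
      rw [← smul_eq_mul, ← Pi.smul_apply, hγ, Pi.add_apply]
      exact congrArg (HAdd.hAdd _) (Finset.sum_apply i.succ _ _)
    simp only [Pi.smul_apply, Pi.sub_apply, Finset.sum_apply, Finset.sum_const, Finset.card_univ,
      Fintype.card_fin, Function.comp_apply, Equiv.swap_apply_left, Fin.tail, smul_eq_mul]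
    rw [nsmul_eq_mul]
    linarith
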